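/- **Proposition 1.2.** Let $R$ be a commutative ring and $\mathcal C$ a category. *Absolute case.* A *cohomology* $H$ on $\mathcal C$ with values in an $R$-linear abelian category $\mathcal A$ is a family $\{H^i\}_{i\in\mathbb N}$ of contravariant functors $H^i:\mathcal C\to\mathcal A$. Its push-forward along a functor $G:\mathcal A\to\mathcal B$ is $G_*H=\{G\circ H^i\}_i$. Let $U$ be the universal cohomology, with values in the free $R$-linear abelian category $\mathcal A(\mathcal C)$ on $\mathcal C^{\mathrm{op}}\times\mathbb N$ ($\mathbb N$ being discrete). For each $H$ with values in $\mathcal A$ let $F_H:\mathcal A(\mathcal C)\to\mathcal A$ be the exact $R$-linear functor, unique up to isomorphism, with $(F_H)_*U\cong H$. Let $\operatorname{Ker}F_H$ be the Serre subcategory of the objects that $F_H$ sends to zero, and $\mathcal A(H)=\mathcal A(\mathcal C)/\operatorname{Ker}F_H$ the Serre quotient. Cohomologies $H$ and $H'$ are *equivalent* if there is an equivalence of categories $\mathcal A(H)\simeq\mathcal A(H')$ compatible, up to isomorphism, with the projections from $\mathcal A(\mathcal C)$. If $H$ and $H'$ have values in $\mathcal A$ and $\mathcal A'$, then $H'$ is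 a *realisation of $H$ along* $G:\mathcal A\to\mathcal A'$ if $G$ is faithful, exact and $R$-linear and $H'\cong G_*H$. For a class $\mathcal S$ of cohomologies on $\mathcal C$ put $\mathcal I_{\mathcal S}=\bigcap_{H\in\mathcal S}\operatorname{Ker}F_H$ and $\mathcal A_{\mathcal S}(\mathcal C)=\mathcal A(\mathcal C)/\mathcal I_{\mathcal S}$, let $U_{\mathcal S}$ be the push-forward of $U$ along the projection $\mathcal A(\mathcal C)\to\mathcal A_{\mathcal S}(\mathcal C)$, and for $H\in\mathcal S$ with values in $\mathcal A$ let $r_H:\mathcal A_{\mathcal S}(\mathcal C)\to\mathcal A$ be the functor induced by $F_H$. The following are equivalent: 1. any $H,H'\in\mathcal S$ are equivalent; 2. $\operatorname{Ker}F_H=\operatorname{Ker}F_{H'}$ for all $H,H'\in\mathcal S$; 3. every $H\in\mathcal S$ is a realisation of $U_{\mathcal S}$ along $r_H$; 4. for every $H\in\mathcal S$ the further quotient functor $\mathcal A_{\mathcal S}(\mathcal C)\to\mathcal A(H)$ is an equivalence of categories. *Relative case.* Let $W$ be a class of morphisms of $\mathcal C$ that is stable under composition. Let $\mathcal C^\square$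 be the category of pairs: its objects $(X,Y)$ are the morphisms $Y\to X$ in $W$, and its morphisms are the commutative squares in $\mathcal C$. A *relative cohomology* with values in an $R$-linear abelian category $\mathcal A$ consists of contravariant functors $H^i:\mathcal C^\square\to\mathcal A$, for $i\in\mathbb N$, and of boundary maps $\partial^i:H^i(Y,Z)\to H^{i+1}(X,Y)$ for all composable $Z\to Y\to X$ in $W$, natural in $Z\to Y\to X$, such that $$0\to H^0(X,Y)\to H^0(X,Z)\to H^0(Y,Z)\xrightarrow{\partial^0}H^1(X,Y)\to H^1(X,Z)\to\cdots$$ is exact. Push-forwards along exact functors and realisations are defined as before, the isomorphism $H'\cong G_*H$ being compatible with the boundary maps. Let $U_\partial$ be the universal relative cohomology, with values in the $R$-linear abelian category $\mathcal A_\partial(\mathcal C)$. For each relative cohomology $H$ with values in $\mathcal A$ let $F_H^\partial:\mathcal A_\partial(\mathcal C)\to\mathcal A$ be the exact $R$-linear functor, unique up to isomorphism, with $(F_H^\partial)_*U_\partial\cong H$, and put $\mathcal A_\partial(H)=\mathcal A_\partial(\mathcal C)/\operatorname{Ker}F_H^\partial$. Relative cohomologies $H$ and $H'$ are *$\partial$-equivalent*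 if there is an equivalence $\mathcal A_\partial(H)\simeq\mathcal A_\partial(H')$ compatible, up to isomorphism, with the projections from $\mathcal A_\partial(\mathcal C)$. For a class $\mathcal S$ of relative cohomologies define $\mathcal I_{\partial,\mathcal S}=\bigcap_{H\in\mathcal S}\operatorname{Ker}F_H^\partial$, $\mathcal A_{\partial,\mathcal S}(\mathcal C)=\mathcal A_\partial(\mathcal C)/\mathcal I_{\partial,\mathcal S}$, $U_{\partial,\mathcal S}$ and $r_{\partial,H}$ as before. The following are equivalent: 1. any $H,H'\in\mathcal S$ are $\partial$-equivalent; 2. $\operatorname{Ker}F_H^\partial=\operatorname{Ker}F_{H'}^\partial$ for all $H,H'\in\mathcal S$; 3. every $H\in\mathcal S$ is a realisation of $U_{\partial,\mathcal S}$ along $r_{\partial,H}$; 4. for every $H\in\mathcal S$ the further quotient functor $\mathcal A_{\partial,\mathcal S}(\mathcal C)\to\mathcal A_\partial(H)$ is an equivalence of categories. -/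

import Mathlib

open CategoryTheory Limits Opposite

universe w u₁ v₁ u₂ v₂ r v u

namespace UnivCoh

/-! ### The free `R`-linear abelian category on a category

It is realised as the category of coherent functors on `D`-modules, where a `D`-module is a functor
from `D` to `R`-modules. -/

section FreeAbelian

variable (R : Type r) [CommRing R] (D : Type u) [Category.{v} D]

/-- The abelian category of all functors from `D`-modules to `R`-modules. -/
abbrev ModFunctor : Type (max v u r (w + 1)) := (D ⥤ ModuleCat.{w} R) ⥤ ModuleCat.{w} R

/-- Coherent functors: the smallest class of functors from `D`-modules to `R`-modules which contains
the evaluations `M ↦ M d` at the objects `d` of `D` and is closed under finite products, kernels and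
cokernels. (Equivalently: the cokernels of the natural transformations
`Hom(N, -) ⟶ Hom(M, -)` with `M` and `N` finitely presented.) -/
inductive IsCoherent : ObjectProperty (ModFunctor.{w} R D)
  | eval (d : D) : IsCoherent ((evaluation D (ModuleCat.{w} R)).obj d)
  | prod {J : Type} [Finite J] {X : Discrete J ⥤ ModFunctor.{w} R D} (c : Cone X)
      (hc : IsLimit c) (hX : ∀ j, IsCoherent (X.obj j)) : IsCoherent c.pt
  | kernel {X Y : ModFunctor.{w} R D} (f : X ⟶ Y) (k : KernelFork f) (hk : IsLimit k)
      (hX : IsCoherent X) (hY : IsCoherent Y) : IsCoherent k.pt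
  | cokernel {X Y : ModFunctor.{w} R D} (f : X ⟶ Y) (k : CokernelCofork f) (hk : IsColimit k)
      (hX : IsCoherent X) (hY : IsCoherent Y) : IsCoherent k.pt

instance : (IsCoherent.{w} R D).IsClosedUnderFiniteProducts where
  isClosedUnderLimitsOfShape J _ :=
    ⟨by rintro _ ⟨p⟩; exact .prod _ p.isLimit p.prop_diag_obj⟩

instance : (IsCoherent.{w} R D).ContainsZero where
  exists_zero := by
    obtain ⟨Z, hZ⟩ := HasZeroObject.zero (C := ModFunctor.{w} R D)
    exact ⟨Z, hZ, .prod (asEmptyCone Z) hZ.isTerminal (by rintro ⟨⟨⟩⟩)⟩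

instance : (IsCoherent.{w} R D).IsClosedUnderKernels where
  kernels_le := by
    rintro _ ⟨f, k, hk, hf⟩
    exact .kernel f k hk hf.1 hf.2

instance : (IsCoherent.{w} R D).IsClosedUnderCokernels where
  cokernels_le := by
    rintro _ ⟨f, k, hk, hf⟩
    exact .cokernel f k hk hf.1 hf.2

/-- The free `R`-linear abelian category on `D` (Freyd), as the full subcategory of coherent functors.
As soon as the universe `w` contains `R` and the hom-sets of `D`, all finitely presented modules
exist in `w` and this category does not depend on `w` up to equivalence. -/
abbrev FreeAb := (IsCoherent.{w} R D).FullSubcategory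

/-- The universal functor from `D` to its free abelian category, sending `d` to evaluation at `d`. -/
abbrev FreeAb.incl : D ⥤ FreeAb.{w} R D :=
  (IsCoherent.{w} R D).lift (evaluation D (ModuleCat.{w} R)) (fun d => .eval d)

end FreeAbelian

/-! ### A fully faithful exact embedding into a category of module-valued functors

`φ : A ⥤ ModuleCat T` is made into a functor to `R`-modules with commuting `T`-action. These are
auxiliary facts for the existence of the exact functors out of the free abelian category. -/

section Rep

variable {A : Type u₁} [Category.{v₁} A] {T : Type*} [Ring T] (φ : A ⥤ ModuleCat.{w} T)

/-- The underlying group of `φ.obj a`. -/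
def repObj (a : A) : Type w := φ.obj a

instance (a : A) : AddCommGroup (repObj φ a) := inferInstanceAs (AddCommGroup (φ.obj a))
instance (a : A) : Module T (repObj φ a) := inferInstanceAs (Module T (φ.obj a))

/-- The map of underlying groups. -/
def repMap {a b : A} (f : a ⟶ b) : repObj φ a →ₗ[T] repObj φ b := (φ.map f).hom

@[simp] lemma repMap_id (a : A) : repMap φ (𝟙 a) = LinearMap.id := by
  simp [repMap]; rfl

@[simp] lemma repMap_comp {a b c : A} (f : a ⟶ b) (g : b ⟶ c) :
    repMap φ (f ≫ g) = (repMap φ g).comp (repMap φ f) := by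
  simp [repMap]; rfl

variable [Preadditive A]

@[simp] lemma repMap_add [φ.Additive] {a b : A} (f g : a ⟶ b) :
    repMap φ (f + g) = repMap φ f + repMap φ g := by
  simp [repMap, φ.map_add]; rfl

@[simp] lemma repMap_zero [φ.Additive] {a b : A} :
    repMap φ (0 : a ⟶ b) = 0 := by
  simp [repMap, φ.map_zero]; rfl

variable (R : Type r) [CommRing R] [Linear R A]

variable {R} in
lemma repMap_smul_id {a b : A} (f : a ⟶ b) (x : R) (m : repObj φ a) :
    repMap φ (x • 𝟙 b) (repMap φ f m) = repMap φ f (repMap φ (x • 𝟙 a) m) := by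
  rw [← LinearMap.comp_apply, ← repMap_comp, ← LinearMap.comp_apply, ← repMap_comp]
  simp

variable [φ.Additive]

/-- `R` acts on `φ.obj a` through the endomorphisms of `a`. -/
instance repModule (a : A) : Module R (repObj φ a) where
  smul x m := repMap φ (x • 𝟙 a) m
  one_smul m := by
    change repMap φ ((1 : R) • 𝟙 a) m = m
    simp
  mul_smul x y m := by
    change repMap φ ((x * y) • 𝟙 a) m = repMap φ (x • 𝟙 a) (repMap φ (y • 𝟙 a) m)
    rw [← LinearMap.comp_apply, ← repMap_comp, Linear.smul_comp, Category.id_comp, smul_smul, mul_comm]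
  smul_zero x := map_zero _
  smul_add x m n := map_add _ m n
  zero_smul m := by
    change repMap φ ((0 : R) • 𝟙 a) m = 0
    simp
  add_smul x y m := by
    change repMap φ ((x + y) • 𝟙 a) m = repMap φ (x • 𝟙 a) m + repMap φ (y • 𝟙 a) m
    simp [add_smul]

variable {R} in
lemma rep_smul_def (a : A) (x : R) (m : repObj φ a) : x • m = repMap φ (x • 𝟙 a) m := rfl

/-- `φ`, as a functor to `R`-modules. -/
def repFunctor : A ⥤ ModuleCat.{w} R where
  obj a := ModuleCat.of R (repObj φ a)
  map {a b} f := ModuleCat.ofHom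
    { toFun := repMap φ f
      map_add' := map_add _
      map_smul' x m := (repMap_smul_id φ f x m).symm }
  map_id a := by ext m; simp
  map_comp f g := by ext m; simp

/-- The action of `T` on `φ.obj a`. -/
def repAct (t : T) (a : A) : repObj φ a →ₗ[R] repObj φ a where
  toFun m := t • m
  map_add' := smul_add _
  map_smul' x m := (map_smul (repMap φ (x • 𝟙 a)) _ m).symm

/-- `φ`, as a functor to `R`-modules with an action of `T`. -/
def rep : SingleObj T ⥤ A ⥤ ModuleCat.{w} R where
  obj _ := repFunctor φ R
  map t :=
    { app a := ModuleCat.ofHom (repAct φ R t a)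
      naturality a b f := by
        ext m
        exact (map_smul (repMap φ f) (show T from t) (show repObj φ a from m)).symm }
  map_id _ := by
    ext a m
    exact one_smul T (show repObj φ a from m)
  map_comp s t := by
    ext a m
    exact mul_smul (show T from t) (show T from s) (show repObj φ a from m)

instance [φ.Faithful] : (rep φ R).flip.Faithful where
  map_injective {a b f g} h := by
    apply φ.map_injective
    ext m
    have := congr_app h (SingleObj.star T)
    exact congr($(this).hom m)

instance [φ.Full] : (rep φ R).flip.Full where
  map_surjective {a b} θ := by
    let f : repObj φ a →ₗ[R] repObj φ b := (θ.app (SingleObj.star T)).hom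
    let g : φ.obj a ⟶ φ.obj b := ModuleCat.ofHom
      { toFun := f
        map_add' := map_add f
        map_smul' t m := by
          have := θ.naturality (X := SingleObj.star T) (Y := SingleObj.star T) t
          exact congr($(this).hom m) }
    refine ⟨φ.preimage g, ?_⟩
    ext k m
    change φ.map (φ.preimage g) m = _
    rw [φ.map_preimage]
    rfl

instance : (rep φ R).flip.Linear R where
  map_smul {a b} f x := by
    ext k m
    have h : repMap φ (x • f) = (repMap φ (x • 𝟙 b)).comp (repMap φ f) := by
      rw [← repMap_comp]
      simp
    exact congr($h m)

lemma repFunctor_exact {A : Type u₁} [Category.{v₁} A] [Abelian A] [Linear R A]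
    (φ : A ⥤ ModuleCat.{w} T) [φ.Additive] [PreservesFiniteLimits φ] [PreservesFiniteColimits φ] :
    PreservesFiniteLimits (repFunctor φ R) ∧ PreservesFiniteColimits (repFunctor φ R) := by
  have : (repFunctor φ R).Additive := ⟨fun {a b f g} => by
    ext m
    exact congr($(repMap_add φ f g) m)⟩
  refine ((repFunctor φ R).exact_tfae.out 1 3).1 fun S hS => ?_
  have h₁ : PreservesFiniteLimits φ ∧ PreservesFiniteColimits φ := ⟨inferInstance, inferInstance⟩
  have h₀ : ∀ S : ShortComplex A, S.Exact → (S.map φ).Exact := (φ.exact_tfae.out 1 3).2 h₁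
  have h := h₀ S hS
  rw [ShortComplex.ShortExact.moduleCat_exact_iff_function_exact] at h ⊢
  exact h

lemma rep_flip_exact {A : Type u₁} [Category.{v₁} A] [Abelian A] [Linear R A]
    (φ : A ⥤ ModuleCat.{w} T) [φ.Additive] [PreservesFiniteLimits φ] [PreservesFiniteColimits φ] :
    PreservesFiniteLimits (rep φ R).flip ∧ PreservesFiniteColimits (rep φ R).flip :=
  ⟨preservesFiniteLimits_of_evaluation _ fun _ => (repFunctor_exact R φ).1,
    preservesFiniteColimits_of_evaluation _ fun _ => (repFunctor_exact R φ).2⟩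

end Rep

section Lift

lemma essImage_of_isLimit {A : Type u₁} [Category.{v₁} A] {B : Type*} [Category* B] (Φ : A ⥤ B) [Φ.Full] [Φ.Faithful]
    {J : Type*} [Category* J] [HasLimitsOfShape J A] [PreservesLimitsOfShape J Φ] {G : J ⥤ B}
    {c : Cone G} (hc : IsLimit c) (hG : ∀ j, Φ.essImage (G.obj j)) : Φ.essImage c.pt :=
  ⟨limit (Functor.essImage.liftFunctor G Φ hG),
    ⟨(isLimitOfPreserves Φ (limit.isLimit (Functor.essImage.liftFunctor G Φ hG))
      ).conePointsIsoOfNatIso hc (Functor.essImage.liftFunctorCompIso G Φ hG)⟩⟩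

lemma essImage_of_isColimit {A : Type u₁} [Category.{v₁} A] {B : Type*} [Category* B] (Φ : A ⥤ B) [Φ.Full] [Φ.Faithful]
    {J : Type*} [Category* J] [HasColimitsOfShape J A] [PreservesColimitsOfShape J Φ] {G : J ⥤ B}
    {c : Cocone G} (hc : IsColimit c) (hG : ∀ j, Φ.essImage (G.obj j)) : Φ.essImage c.pt :=
  ⟨colimit (Functor.essImage.liftFunctor G Φ hG),
    ⟨(isColimitOfPreserves Φ (colimit.isColimit (Functor.essImage.liftFunctor G Φ hG))
      ).coconePointsIsoOfNatIso hc (Functor.essImage.liftFunctorCompIso G Φ hG)⟩⟩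

variable (R : Type r) [CommRing R] {D : Type u} [Category.{v} D]

lemma FreeAb.ι_exact : PreservesFiniteLimits (IsCoherent.{w} R D).ι ∧
    PreservesFiniteColimits (IsCoherent.{w} R D).ι := by
  have := (IsCoherent.{w} R D).preservesKernels_ι
  have := (IsCoherent.{w} R D).preservesCokernels_ι
  exact ⟨((Functor.preservesFiniteLimits_tfae (IsCoherent.{w} R D).ι).out 2 3 :).1
      fun _ _ f => inferInstance,
    ((Functor.preservesFiniteColimits_tfae (IsCoherent.{w} R D).ι).out 2 3 :).1
      fun _ _ f => inferInstance⟩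

variable {A : Type u₁} [Category.{v₁} A] [Abelian A] [Linear R A]

theorem FreeAb.exists_lift_of_rep {K : Type*} [Category* K] (Φ : K ⥤ A ⥤ ModuleCat.{w} R)
   [Φ.flip.Full] [Φ.flip.Faithful] [Φ.flip.Linear R] [PreservesFiniteLimits Φ.flip]
   [PreservesFiniteColimits Φ.flip] (H : D ⥤ A) : ∃ F : FreeAb.{w} R D ⥤ A,
     PreservesFiniteLimits F ∧ PreservesFiniteColimits F ∧ F.Linear R ∧
      Nonempty (FreeAb.incl.{w} R D ⋙ F ≅ H) := by
  let E₀ : ModFunctor.{w} R D ⥤ K ⥤ ModuleCat.{w} R :=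
    (Functor.whiskeringLeft K (D ⥤ ModuleCat.{w} R) (ModuleCat.{w} R)).obj
      (Φ ⋙ (Functor.whiskeringLeft _ _ _).obj H)
  have : E₀.Linear R := ⟨fun f x => rfl⟩
  have : E₀.Additive := ⟨rfl⟩
  have hl : PreservesFiniteLimits E₀ :=
    preservesFiniteLimits_of_evaluation _ fun k => by
      change PreservesFiniteLimits ((evaluation _ _).obj (H ⋙ Φ.obj k))
      infer_instance
  have hc : PreservesFiniteColimits E₀ :=
    preservesFiniteColimits_of_evaluation _ fun k => by
      change PreservesFiniteColimits ((evaluation _ _).obj (H ⋙ Φ.obj k))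
      infer_instance
  have hE : ∀ X, IsCoherent R D X → Φ.flip.essImage (E₀.obj X) := by
    intro X hX
    induction hX with
    | eval d => exact ⟨H.obj d, ⟨Iso.refl _⟩⟩
    | prod c hc hX ih =>
      have := Fintype.ofFinite
      exact essImage_of_isLimit Φ.flip (isLimitOfPreserves E₀ hc) ih
    | kernel f k hk hX hY ihX ihY =>
      exact essImage_of_isLimit Φ.flip (isLimitOfPreserves E₀ hk) (by rintro (_ | _) <;> assumption)
    | cokernel f k hk hX hY ihX ihY =>
      exact essImage_of_isColimit Φ.flip (isColimitOfPreserves E₀ hk)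
        (by rintro (_ | _) <;> assumption)
  let E : FreeAb.{w} R D ⥤ K ⥤ ModuleCat.{w} R := (IsCoherent.{w} R D).ι ⋙ E₀
  have := (FreeAb.ι_exact.{w} R (D := D)).1
  have := (FreeAb.ι_exact.{w} R (D := D)).2
  have : PreservesFiniteLimits E := comp_preservesFiniteLimits _ _
  have : PreservesFiniteColimits E := comp_preservesFiniteColimits _ _
  have : E.Linear R := ⟨fun f x => rfl⟩
  let F := Functor.essImage.liftFunctor E Φ.flip (fun X => hE _ X.2)
  let e : F ⋙ Φ.flip ≅ E := Functor.essImage.liftFunctorCompIso _ _ _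
  have : PreservesFiniteLimits (F ⋙ Φ.flip) := preservesFiniteLimits_of_natIso e.symm
  have : PreservesFiniteColimits (F ⋙ Φ.flip) := preservesFiniteColimits_of_natIso e.symm
  have : (F ⋙ Φ.flip).Linear R := Functor.linear_of_iso _ e.symm
  have e' : (FreeAb.incl.{w} R D ⋙ F) ⋙ Φ.flip ≅ H ⋙ Φ.flip :=
    Functor.isoWhiskerLeft (FreeAb.incl.{w} R D) e
  exact ⟨F, preservesFiniteLimits_of_reflects_of_preserves _ Φ.flip,
    preservesFiniteColimits_of_reflects_of_preserves _ Φ.flip,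
    ⟨fun f x => Φ.flip.map_injective (by
      rw [Φ.flip.map_smul]; exact (F ⋙ Φ.flip).map_smul x f)⟩,
      ⟨Functor.fullyFaithfulCancelRight Φ.flip e'⟩⟩

/-- Every functor from `D` to an `R`-linear abelian category `A` extends along `D ⥤ FreeAb R D` to an
exact `R`-linear functor. -/
theorem FreeAb.exists_lift (H : D ⥤ A) : ∃ F : FreeAb.{max w u₁ v₁} R D ⥤ A,
     PreservesFiniteLimits F ∧ PreservesFiniteColimits F ∧ F.Linear R ∧
      Nonempty (FreeAb.incl.{max w u₁ v₁} R D ⋙ F ≅ H) := by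
  let φ := Abelian.FreydMitchell.functor A ⋙ ModuleCat.uliftFunctor.{w} _
  have : PreservesFiniteLimits φ := comp_preservesFiniteLimits _ _
  have : PreservesFiniteColimits φ := comp_preservesFiniteColimits _ _
  have : φ.Additive := Functor.additive_of_preserves_binary_products φ
  have := (rep_flip_exact R φ).1
  have := (rep_flip_exact R φ).2
  exact FreeAb.exists_lift_of_rep.{max w u₁ v₁} R (rep φ R) H
end Lift

/-! ### Serre quotients -/

section Serre

variable {𝒰 : Type u} [Category.{v} 𝒰] [Abelian 𝒰]

lemma isSerreClass_forall {ι : Sort*} (P : ι → ObjectProperty 𝒰) [hP : ∀ i, (P i).IsSerreClass] :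
    ObjectProperty.IsSerreClass (fun X => ∀ i, P i X) where
  exists_zero := ⟨_, isZero_zero 𝒰, fun i => (P i).prop_zero⟩
  prop_of_mono f _ h i := (P i).prop_of_mono f (h i)
  prop_of_epi f _ h i := (P i).prop_of_epi f (h i)
  prop_X₂_of_shortExact hS h₁ h₃ i := (P i).prop_X₂_of_shortExact hS (h₁ i) (h₃ i)

/-- The smallest Serre subcategory containing the objects satisfying `P`. -/
def serreClosure (P : ObjectProperty 𝒰) : ObjectProperty 𝒰 :=
  fun X => ∀ Q : {Q : ObjectProperty 𝒰 // Q.IsSerreClass ∧ P ≤ Q}, Q.1 X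

instance (P : ObjectProperty 𝒰) : (serreClosure P).IsSerreClass :=
  have (Q : {Q : ObjectProperty 𝒰 // Q.IsSerreClass ∧ P ≤ Q}) : Q.1.IsSerreClass := Q.2.1
  isSerreClass_forall fun Q : {Q : ObjectProperty 𝒰 // Q.IsSerreClass ∧ P ≤ Q} => Q.1

lemma le_serreClosure (P : ObjectProperty 𝒰) : P ≤ serreClosure P := fun _ h Q => Q.2.2 _ h

lemma serreClosure_le {P Q : ObjectProperty 𝒰} [hQ : Q.IsSerreClass] (h : P ≤ Q) :
    serreClosure P ≤ Q := fun _ hX => hX ⟨Q, hQ, h⟩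

/-- The Serre quotient of an abelian category by a Serre subcategory. -/
abbrev SerreQuotient (P : ObjectProperty 𝒰) [P.IsSerreClass] := P.isoModSerre.Localization

/-- The projection to the Serre quotient. -/
abbrev SerreQuotient.proj (P : ObjectProperty 𝒰) [P.IsSerreClass] : 𝒰 ⥤ SerreQuotient P :=
  P.isoModSerre.Q

noncomputable instance (P : ObjectProperty 𝒰) [P.IsSerreClass] : Abelian (SerreQuotient P) :=
  ObjectProperty.SerreClassLocalization.abelian P.isoModSerre.Q P

/-- Exactness of a functor between abelian categories. -/
structure IsExact {A : Type u₁} [Category.{v₁} A] (F : 𝒰 ⥤ A) : Prop where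
  preservesFiniteLimits : PreservesFiniteLimits F
  preservesFiniteColimits : PreservesFiniteColimits F

lemma IsExact.of_iso {A : Type u₁} [Category.{v₁} A] {F G : 𝒰 ⥤ A} (hF : IsExact F)
    (e : F ≅ G) : IsExact G :=
  have := hF.1
  have := hF.2
  ⟨preservesFiniteLimits_of_natIso e, preservesFiniteColimits_of_natIso e⟩

/-- Exact `R`-linear functors: the morphisms between `R`-linear abelian categories. -/
structure IsExactLinear (R : Type r) [CommRing R] [Linear R 𝒰] {A : Type u₁} [Category.{v₁} A]
    [Abelian A] [Linear R A] (F : 𝒰 ⥤ A) : Prop extends IsExact F where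
  linear : F.Linear R

section Ker

variable {A : Type u₁} [Category.{v₁} A] [Abelian A]

/-- The kernel `Ker F` of a functor: the objects sent to zero. -/
def Ker (F : 𝒰 ⥤ A) : ObjectProperty 𝒰 := fun X => IsZero (F.obj X)

lemma Ker_isSerreClass {F : 𝒰 ⥤ A} (hF : IsExact F) : (Ker F).IsSerreClass :=
  have := hF.1
  have := hF.2
  inferInstanceAs (ObjectProperty.inverseImage (IsZero (C := A)) F).IsSerreClass

lemma isInvertedBy_of_le_Ker {F : 𝒰 ⥤ A} (hF : IsExact F)
    (P : ObjectProperty 𝒰) [P.IsSerreClass] (h : P ≤ Ker F) : P.isoModSerre.IsInvertedBy F := by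
  intro X Y f hf
  have := hF.1
  have := hF.2
  have := F.additive_of_preserves_binary_products
  have h₁ : Mono (F.map f) := by
    have := (h _ hf.1 : IsZero (F.obj (kernel f)))
    exact Preadditive.mono_of_isZero_kernel _ (this.of_iso (PreservesKernel.iso F f).symm)
  have h₂ : Epi (F.map f) := by
    have := (h _ hf.2 : IsZero (F.obj (cokernel f)))
    exact Preadditive.epi_of_isZero_cokernel _ (this.of_iso (PreservesCokernel.iso F f).symm)
  exact isIso_of_mono_of_epi _

/-- The functor on the Serre quotient by `P` induced by an exact functor which kills `P`. -/
noncomputable def SerreQuotient.lift {F : 𝒰 ⥤ A} (hF : IsExact F)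
    (P : ObjectProperty 𝒰) [P.IsSerreClass] (h : P ≤ Ker F) : SerreQuotient P ⥤ A :=
  Localization.lift F (isInvertedBy_of_le_Ker hF P h) (SerreQuotient.proj P)

/-- The induced functor composed with the projection is the given functor. -/
noncomputable def SerreQuotient.fac {F : 𝒰 ⥤ A} (hF : IsExact F)
    (P : ObjectProperty 𝒰) [P.IsSerreClass] (h : P ≤ Ker F) :
    SerreQuotient.proj P ⋙ SerreQuotient.lift hF P h ≅ F :=
  Localization.fac F (isInvertedBy_of_le_Ker hF P h) (SerreQuotient.proj P)

end Ker

lemma SerreQuotient.proj_isExact (P : ObjectProperty 𝒰) [P.IsSerreClass] :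
    IsExact (SerreQuotient.proj P) where
  preservesFiniteLimits := ObjectProperty.SerreClassLocalization.preservesFiniteLimits _ P
  preservesFiniteColimits := ObjectProperty.SerreClassLocalization.preservesFiniteColimits _ P

lemma SerreQuotient.le_Ker_proj {P Q : ObjectProperty 𝒰} [Q.IsSerreClass] (h : P ≤ Q) :
    P ≤ Ker (SerreQuotient.proj Q) :=
  fun X hX => (ObjectProperty.SerreClassLocalization.isZero_obj_iff (SerreQuotient.proj Q) Q X).2
    (h X hX)

/-- The further quotient `𝒰 / P ⥤ 𝒰 / Q` for Serre subcategories `P ⊆ Q`. -/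
noncomputable def SerreQuotient.map {P Q : ObjectProperty 𝒰} [P.IsSerreClass] [Q.IsSerreClass]
    (h : P ≤ Q) : SerreQuotient P ⥤ SerreQuotient Q :=
  SerreQuotient.lift (SerreQuotient.proj_isExact Q) P (SerreQuotient.le_Ker_proj h)

variable (R : Type r) [CommRing R] [Linear R 𝒰]

lemma SerreQuotient.proj_isExactLinear (P : ObjectProperty 𝒰) [P.IsSerreClass] :
    IsExactLinear R (SerreQuotient.proj P) where
  toIsExact := SerreQuotient.proj_isExact P
  linear := inferInstance

variable {R} in
lemma SerreQuotient.lift_isExactLinear {A : Type u₁} [Category.{v₁} A] [Abelian A] [Linear R A]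
    {F : 𝒰 ⥤ A} (hF : IsExactLinear R F) (P : ObjectProperty 𝒰) [P.IsSerreClass]
    (h : P ≤ Ker F) : IsExactLinear R (SerreQuotient.lift hF.toIsExact P h) := by
  have h' := hF.toIsExact.of_iso (SerreQuotient.fac hF.toIsExact P h).symm
  have : Localization.Lifting (SerreQuotient.proj P) P.isoModSerre F
      (SerreQuotient.lift hF.toIsExact P h) := ⟨SerreQuotient.fac hF.toIsExact P h⟩
  exact ⟨⟨(ObjectProperty.SerreClassLocalization.preservesFiniteLimits_comp_iff _ P _).1 h'.1,
    (ObjectProperty.SerreClassLocalization.preservesFiniteColimits_comp_iff _ P _).1 h'.2⟩,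
    (Localization.functor_linear_iff (SerreQuotient.proj P) P.isoModSerre R F _).1 hF.linear⟩

end Serre

/-! ### Cohomologies -/

section Absolute

/-- A cohomology on `C`: a family of contravariant functors `H i`, for `i : ℕ`, from `C` to an
`R`-linear abelian category `A`. -/
structure Cohomology (R : Type r) [CommRing R] (C : Type u) [Category.{v} C] where
  A : Type u₁
  [category : Category.{v₁} A]
  [abelian : Abelian A]
  [linear : Linear R A]
  H : ℕ → Cᵒᵖ ⥤ A

attribute [instance] Cohomology.category Cohomology.abelian Cohomology.linear

variable {R : Type r} [CommRing R] {C : Type u} [Category.{v} C]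

namespace Cohomology

/-- The push-forward `G_* H` of a cohomology along a functor. -/
def pushforward (H : Cohomology.{u₁, v₁} R C) {B : Type u₂} [Category.{v₂} B] [Abelian B]
    [Linear R B] (G : H.A ⥤ B) : Cohomology.{u₂, v₂} R C where
  A := B
  H i := H.H i ⋙ G

/-- `H'` is the push-forward of `H` along `G`, up to isomorphism. -/
def IsPushforward (H : Cohomology.{u₁, v₁} R C) (H' : Cohomology.{u₂, v₂} R C)
    (G : H.A ⥤ H'.A) : Prop :=
  ∀ i, Nonempty ((H.pushforward G).H i ≅ H'.H i)

/-- `H'` is a realisation of `H` along `G`: the functor `G` is faithful, exact and `R`-linear, and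
`H'` is the push-forward of `H` along `G`. -/
structure IsRealisation (H : Cohomology.{u₁, v₁} R C) (H' : Cohomology.{u₂, v₂} R C)
    (G : H.A ⥤ H'.A) : Prop where
  faithful : G.Faithful
  exact : IsExactLinear R G
  isPushforward : H.IsPushforward H' G

variable (R C) in
/-- The category `𝒜(C)`: the free `R`-linear abelian category on the `ℕ`-indexed copies
of `Cᵒᵖ`. -/
abbrev Univ := FreeAb.{max w r v u} R (Discrete ℕ × Cᵒᵖ)

variable (R C) in
/-- The universal cohomology `U`, with values in `𝒜(C)`. -/
noncomputable def univ :
    Cohomology.{max (w + 1) (r + 1) (v + 1) (u + 1), max (w + 1) (r + 1) (v + 1) (u + 1)} R C where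
  A := Univ.{w} R C
  H i := Prod.sectR ⟨i⟩ Cᵒᵖ ⋙ FreeAb.incl R (Discrete ℕ × Cᵒᵖ)

variable (H : Cohomology.{u₁, v₁} R C)

theorem exists_classifying : ∃ F : Univ.{max u₁ v₁} R C ⥤ H.A,
    IsExactLinear R F ∧ (univ.{max u₁ v₁} R C).IsPushforward H F := by
  obtain ⟨F, h₁, h₂, h₃, ⟨e⟩⟩ := FreeAb.exists_lift.{max r v u} R
    (Functor.uncurry.obj (Discrete.functor H.H) : Discrete ℕ × Cᵒᵖ ⥤ H.A)
  refine ⟨F, ⟨⟨h₁, h₂⟩, h₃⟩, fun i => ?_⟩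
  have e₁ := Functor.isoWhiskerLeft (Prod.sectR (⟨i⟩ : Discrete ℕ) Cᵒᵖ) e
  have e₂ : Prod.sectR (⟨i⟩ : Discrete ℕ) Cᵒᵖ ⋙ Functor.uncurry.obj (Discrete.functor H.H) ≅
      H.H i := NatIso.ofComponents (fun X => Iso.refl _) (fun {X Y} f => by
        change (((Discrete.functor H.H).map (𝟙 (⟨i⟩ : Discrete ℕ))).app X ≫ (H.H i).map f) ≫ 𝟙 _ =
          𝟙 _ ≫ (H.H i).map f
        rw [CategoryTheory.Functor.map_id, NatTrans.id_app, Category.comp_id]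
        rfl)
  exact ⟨e₁ ≪≫ e₂⟩

/-- The exact `R`-linear functor `F_H : 𝒜(C) ⥤ A` through which `H` is the push-forward of `U`. -/
noncomputable def classifying : Univ.{max u₁ v₁} R C ⥤ H.A := H.exists_classifying.choose

lemma classifying_isExactLinear : IsExactLinear R H.classifying :=
  H.exists_classifying.choose_spec.1

lemma classifying_isPushforward : (univ.{max u₁ v₁} R C).IsPushforward H H.classifying :=
  H.exists_classifying.choose_spec.2

/-- `Ker F_H`. -/
abbrev kernel : ObjectProperty (Univ.{max u₁ v₁} R C) := Ker H.classifying

instance : H.kernel.IsSerreClass := Ker_isSerreClass H.classifying_isExactLinear.toIsExact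

/-- `𝒜(H) = 𝒜(C) / Ker F_H`. -/
abbrev Quot := SerreQuotient H.kernel

/-- Two cohomologies are equivalent if there is an equivalence `𝒜(H) ≌ 𝒜(H')` compatible with the
projections from `𝒜(C)`. -/
def IsEquivalent (H H' : Cohomology.{u₁, v₁} R C) : Prop :=
  ∃ e : H.Quot ≌ H'.Quot,
    Nonempty (SerreQuotient.proj H.kernel ⋙ e.functor ≅ SerreQuotient.proj H'.kernel)

variable (S : Set (Cohomology.{u₁, v₁} R C))

/-- `ℐ_S`, the intersection of the kernels `Ker F_H` for `H ∈ S`. -/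
def commonKernel : ObjectProperty (Univ.{max u₁ v₁} R C) := fun X => ∀ H : S, H.1.kernel X

instance : (commonKernel S).IsSerreClass := isSerreClass_forall fun H : S => H.1.kernel

lemma commonKernel_le {S : Set (Cohomology.{u₁, v₁} R C)} {H : Cohomology.{u₁, v₁} R C}
    (hH : H ∈ S) : commonKernel S ≤ H.kernel := fun _ hX => hX ⟨H, hH⟩

/-- `𝒜_S(C) = 𝒜(C) / ℐ_S`. -/
abbrev ClassQuot := SerreQuotient (commonKernel S)

/-- `U_S`, the push-forward of `U` along the projection to `𝒜_S(C)`. -/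
noncomputable abbrev classUniv :=
  (univ.{max u₁ v₁} R C).pushforward (SerreQuotient.proj (commonKernel S))

variable {S} {H} (hH : H ∈ S)

/-- `r_H : 𝒜_S(C) ⥤ A`, the functor induced by `F_H`. -/
noncomputable def realisation : ClassQuot S ⥤ H.A :=
  SerreQuotient.lift H.classifying_isExactLinear.toIsExact (commonKernel S) (commonKernel_le hH)

/-- The further quotient `𝒜_S(C) ⥤ 𝒜(H)`. -/
noncomputable def toQuot : ClassQuot S ⥤ H.Quot := SerreQuotient.map (commonKernel_le hH)

end Cohomology

end Absolute

/-! ### Relative cohomologies -/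

section Relative

variable {R : Type r} [CommRing R] {C : Type u} [Category.{v} C] (W : MorphismProperty C)

/-- The category of pairs: its objects `(X, Y)` are the morphisms `Y ⟶ X` in the distinguished class
`W`, its morphisms are the commutative squares in `C`. -/
abbrev Pairs := ObjectProperty.FullSubcategory (fun a : Arrow C => W a.hom)

/-- A triple `Z ⟶ Y ⟶ X` of composable morphisms in `W`. -/
structure Triple where
  {X Y Z : C}
  i : Y ⟶ X
  j : Z ⟶ Y
  hi : W i
  hj : W j

variable {W}

/-- Morphisms of triples. -/
structure Triple.Hom (t t' : Triple W) where
  x : t.X ⟶ t'.X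
  y : t.Y ⟶ t'.Y
  z : t.Z ⟶ t'.Z
  wi : t.i ≫ x = y ≫ t'.i
  wj : t.j ≫ y = z ≫ t'.j

namespace Triple

variable (t : Triple W) {t' : Triple W} (f : Triple.Hom t t')

/-- The pair `(X, Y)`. -/
def XY : Pairs W := ⟨Arrow.mk t.i, t.hi⟩

/-- The pair `(Y, Z)`. -/
def YZ : Pairs W := ⟨Arrow.mk t.j, t.hj⟩

/-- The pair `(X, Z)`. -/
def XZ [W.IsStableUnderComposition] : Pairs W := ⟨Arrow.mk (t.j ≫ t.i), W.comp_mem _ _ t.hj t.hi⟩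

/-- The morphism of pairs `(Y, Z) ⟶ (X, Z)`. -/
def toXZ [W.IsStableUnderComposition] : t.YZ ⟶ t.XZ :=
  ObjectProperty.homMk (Arrow.homMk' (𝟙 t.Z) t.i)

/-- The morphism of pairs `(X, Z) ⟶ (X, Y)`. -/
def toXY [W.IsStableUnderComposition] : t.XZ ⟶ t.XY :=
  ObjectProperty.homMk (Arrow.homMk' t.j (𝟙 t.X))

variable {t}

/-- The morphism induced on the pairs `(X, Y)`. -/
def Hom.XY : t.XY ⟶ t'.XY := ObjectProperty.homMk (Arrow.homMk' f.y f.x f.wi.symm)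

/-- The morphism induced on the pairs `(Y, Z)`. -/
def Hom.YZ : t.YZ ⟶ t'.YZ := ObjectProperty.homMk (Arrow.homMk' f.z f.y f.wj.symm)

end Triple

/-- Exactness of `X ⟶ Y ⟶ Z` at `Y`. -/
def ExactAt {A : Type u₁} [Category.{v₁} A] [Abelian A] {X Y Z : A} (f : X ⟶ Y) (g : Y ⟶ Z) : Prop :=
  ∃ w : f ≫ g = 0, (ShortComplex.mk f g w).Exact

/-- A relative cohomology: contravariant functors `H i`, for `i : ℕ`, from pairs to an `R`-linear
abelian category, with natural boundary maps `δ : H i (Y, Z) ⟶ H (i + 1) (X, Y)` for the triples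
`Z ⟶ Y ⟶ X`, such that the sequence
`0 ⟶ H 0 (X, Y) ⟶ H 0 (X, Z) ⟶ H 0 (Y, Z) ⟶ H 1 (X, Y) ⟶ H 1 (X, Z) ⟶ ⋯` is exact. -/
structure RelCohomology (R : Type r) [CommRing R] (W : MorphismProperty C)
    [W.IsStableUnderComposition] where
  A : Type u₁
  [category : Category.{v₁} A]
  [abelian : Abelian A]
  [linear : Linear R A]
  H : ℕ → (Pairs W)ᵒᵖ ⥤ A
  δ (i : ℕ) (t : Triple W) : (H i).obj (op t.YZ) ⟶ (H (i + 1)).obj (op t.XY)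
  δ_naturality (i : ℕ) {t t' : Triple W} (f : t.Hom t') :
    (H i).map f.YZ.op ≫ δ i t = δ i t' ≫ (H (i + 1)).map f.XY.op
  mono (t : Triple W) : Mono ((H 0).map t.toXY.op)
  exact_XZ (i : ℕ) (t : Triple W) : ExactAt ((H i).map t.toXY.op) ((H i).map t.toXZ.op)
  exact_YZ (i : ℕ) (t : Triple W) : ExactAt ((H i).map t.toXZ.op) (δ i t)
  exact_XY (i : ℕ) (t : Triple W) : ExactAt (δ i t) ((H (i + 1)).map t.toXY.op)

attribute [instance] RelCohomology.category RelCohomology.abelian RelCohomology.linear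

/-! The category obtained from `ℕ`-indexed copies of the opposite of the category of pairs by freely
adjoining natural boundary morphisms `(Y, Z, i) ⟶ (X, Y, i + 1)`. -/

variable (W) in
/-- The objects `(X, Y, i)`. -/
structure Vertex where
  pair : Pairs W
  degree : ℕ

/-- The generating morphisms. -/
inductive Edge : Vertex W → Vertex W → Type (max u v)
  | map {p q : Pairs W} (f : p ⟶ q) (i : ℕ) : Edge ⟨q, i⟩ ⟨p, i⟩
  | δ (i : ℕ) (t : Triple W) : Edge ⟨t.YZ, i⟩ ⟨t.XY, i + 1⟩

instance : Quiver (Vertex W) := ⟨Edge⟩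

/-- The generator given by a morphism of pairs. -/
def edgeMap {p q : Pairs W} (f : p ⟶ q) (i : ℕ) :
    (Paths.of (Vertex W)).obj ⟨q, i⟩ ⟶ (Paths.of (Vertex W)).obj ⟨p, i⟩ :=
  (Paths.of (Vertex W)).map (Edge.map f i)

/-- The boundary generator. -/
def edgeδ (i : ℕ) (t : Triple W) :
    (Paths.of (Vertex W)).obj ⟨t.YZ, i⟩ ⟶ (Paths.of (Vertex W)).obj ⟨t.XY, i + 1⟩ :=
  (Paths.of (Vertex W)).map (Edge.δ i t)

variable (W) in
/-- The relations: functoriality, and naturality of the boundary. -/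
inductive Relation : HomRel (Paths (Vertex W))
  | id (p : Pairs W) (i : ℕ) : Relation (edgeMap (𝟙 p) i) (𝟙 _)
  | comp {p q s : Pairs W} (f : p ⟶ q) (g : q ⟶ s) (i : ℕ) :
    Relation (edgeMap (f ≫ g) i) (edgeMap g i ≫ edgeMap f i)
  | naturality (i : ℕ) {t t' : Triple W} (f : t.Hom t') :
    Relation (edgeMap f.YZ i ≫ edgeδ i t) (edgeδ i t' ≫ edgeMap f.XY (i + 1))

variable (W) in
/-- The category with these generators and relations. Functors out of it are the families of
contravariant functors on pairs with natural boundary maps. -/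
abbrev BoundaryCat := CategoryTheory.Quotient (Relation W)

variable (W) in
/-- The tautological functors. -/
def BoundaryCat.H (i : ℕ) : (Pairs W)ᵒᵖ ⥤ BoundaryCat W where
  obj p := (Quotient.functor (Relation W)).obj ((Paths.of (Vertex W)).obj ⟨p.unop, i⟩)
  map f := (Quotient.functor (Relation W)).map (edgeMap f.unop i)
  map_id p := CategoryTheory.Quotient.sound _ (.id _ _)
  map_comp f g := CategoryTheory.Quotient.sound _ (.comp _ _ _)

/-- The tautological boundary maps. -/
def BoundaryCat.δ (i : ℕ) (t : Triple W) :
    (BoundaryCat.H W i).obj (op t.YZ) ⟶ (BoundaryCat.H W (i + 1)).obj (op t.XY) :=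
  (Quotient.functor (Relation W)).map (edgeδ i t)

lemma BoundaryCat.naturality (i : ℕ) {t t' : Triple W} (f : t.Hom t') :
    (BoundaryCat.H W i).map f.YZ.op ≫ BoundaryCat.δ i t =
      BoundaryCat.δ i t' ≫ (BoundaryCat.H W (i + 1)).map f.XY.op :=
  CategoryTheory.Quotient.sound _ (.naturality _ _)

/-- The two objects which an exact functor has to kill for the image of `X ⟶ Y ⟶ Z` to be exact
at `Y`. -/
inductive defect {A : Type u₁} [Category.{v₁} A] [Abelian A] {X Y Z : A} (f : X ⟶ Y) (g : Y ⟶ Z) :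
    ObjectProperty A
  | comp : defect f g (Abelian.image (f ≫ g))
  | homology : defect f g (Abelian.image (kernel.ι g ≫ cokernel.π f))

variable [W.IsStableUnderComposition]

variable (R W) in
/-- The free `R`-linear abelian category on `BoundaryCat W`. -/
abbrev FreeRel := FreeAb.{max w r v u} R (BoundaryCat W)

variable (R W) in
/-- The tautological functors with values in the free abelian category. -/
abbrev FreeRel.H (i : ℕ) : (Pairs W)ᵒᵖ ⥤ FreeRel.{w} R W :=
  BoundaryCat.H W i ⋙ FreeAb.incl R (BoundaryCat W)

variable (R) in
/-- The tautological boundary maps in the free abelian category. -/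
abbrev FreeRel.δ (i : ℕ) (t : Triple W) :
    (FreeRel.H.{w} R W i).obj (op t.YZ) ⟶ (FreeRel.H.{w} R W (i + 1)).obj (op t.XY) :=
  (FreeAb.incl R (BoundaryCat W)).map (BoundaryCat.δ i t)

variable (R W) in
/-- The objects to kill for the long sequences of all triples to become exact. -/
inductive exactnessDefect : ObjectProperty (FreeRel.{w} R W)
  | mono (t : Triple W) : exactnessDefect (kernel ((FreeRel.H.{w} R W 0).map t.toXY.op))
  | exact_XZ (i : ℕ) (t : Triple W) {D : FreeRel.{w} R W}
    (hD : defect ((FreeRel.H.{w} R W i).map t.toXY.op) ((FreeRel.H.{w} R W i).map t.toXZ.op) D) :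
    exactnessDefect D
  | exact_YZ (i : ℕ) (t : Triple W) {D : FreeRel.{w} R W}
    (hD : defect ((FreeRel.H.{w} R W i).map t.toXZ.op) (FreeRel.δ R i t) D) : exactnessDefect D
  | exact_XY (i : ℕ) (t : Triple W) {D : FreeRel.{w} R W}
    (hD : defect (FreeRel.δ R i t) ((FreeRel.H.{w} R W (i + 1)).map t.toXY.op) D) :
    exactnessDefect D

variable (R W) in
/-- The category `𝒜_∂(C)`: the Serre quotient of the free abelian category by the smallest Serre
subcategory for which the long sequences of triples become exact. -/
abbrev UnivRel := SerreQuotient (serreClosure (exactnessDefect.{w} R W))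

lemma isZero_map_image_iff {A : Type u₁} [Category.{v₁} A] [Abelian A]
    {B : Type u₂} [Category.{v₂} B] [Abelian B] {F : A ⥤ B} (hF : IsExact F) {P Q : A}
    (h : P ⟶ Q) : IsZero (F.obj (Abelian.image h)) ↔ F.map h = 0 := by
  have := hF.1
  have := hF.2
  have := F.additive_of_preserves_binary_products
  have hh : F.map h = F.map (Abelian.factorThruImage h) ≫ F.map (Abelian.image.ι h) := by
    rw [← F.map_comp, Abelian.image.fac]
  rw [hh]
  refine ⟨fun hz => by rw [hz.eq_of_tgt (F.map (Abelian.factorThruImage h)) 0, zero_comp],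
    fun h₀ => ?_⟩
  have h₁ : F.map (Abelian.image.ι h) = 0 := by
    rwa [← cancel_epi (F.map (Abelian.factorThruImage h)), comp_zero]
  exact IsZero.of_mono_eq_zero (F.map (Abelian.image.ι h)) h₁

lemma exactAt_map_iff {A : Type u₁} [Category.{v₁} A] [Abelian A]
    {B : Type u₂} [Category.{v₂} B] [Abelian B] {F : A ⥤ B} (hF : IsExact F)
    {X Y Z : A} (f : X ⟶ Y) (g : Y ⟶ Z) :
    ExactAt (F.map f) (F.map g) ↔ ∀ D, defect f g D → IsZero (F.obj D) := by
  have := hF.1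
  have := hF.2
  have := F.additive_of_preserves_binary_products
  have h₁ : F.map (kernel.ι g ≫ cokernel.π f) = 0 ↔
      kernel.ι (F.map g) ≫ cokernel.π (F.map f) = 0 := by
    rw [← cancel_epi (PreservesKernel.iso F g).inv,
      ← cancel_mono (PreservesCokernel.iso F f).hom, F.map_comp]
    simp
  have h₂ : (∀ D, defect f g D → IsZero (F.obj D)) ↔
      F.map (f ≫ g) = 0 ∧ F.map (kernel.ι g ≫ cokernel.π f) = 0 := by
    rw [← isZero_map_image_iff hF, ← isZero_map_image_iff hF]
    exact ⟨fun h => ⟨h _ .comp, h _ .homology⟩, by rintro ⟨h, h'⟩ _ (_ | _) <;> assumption⟩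
  rw [h₂, h₁, F.map_comp]
  constructor
  · rintro ⟨w, hw⟩
    exact ⟨w, (ShortComplex.exact_iff_kernel_ι_comp_cokernel_π_zero _).1 hw⟩
  · rintro ⟨w, hw⟩
    exact ⟨w, (ShortComplex.exact_iff_kernel_ι_comp_cokernel_π_zero
      (ShortComplex.mk _ _ w)).2 hw⟩

lemma ExactAt.map {A : Type u₁} [Category.{v₁} A] [Abelian A]
    {B : Type u₂} [Category.{v₂} B] [Abelian B] {F : A ⥤ B} (hF : IsExact F)
    {X Y Z : A} {f : X ⟶ Y} {g : Y ⟶ Z} (h : ExactAt f g) : ExactAt (F.map f) (F.map g) := by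
  rw [exactAt_map_iff hF]
  have h' := (exactAt_map_iff (F := 𝟭 A) ⟨inferInstance, inferInstance⟩ f g).1 h
  have := hF.1
  have := hF.2
  have := F.additive_of_preserves_binary_products
  exact fun D hD => F.map_isZero (h' D hD)

lemma ExactAt.of_iso {A : Type u₁} [Category.{v₁} A] [Abelian A] {X Y Z X' Y' Z' : A}
    {f : X ⟶ Y} {g : Y ⟶ Z} {f' : X' ⟶ Y'} {g' : Y' ⟶ Z'} (h : ExactAt f g)
    (a : X ≅ X') (b : Y ≅ Y') (c : Z ≅ Z') (hf : f ≫ b.hom = a.hom ≫ f')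
    (hg : g ≫ c.hom = b.hom ≫ g') : ExactAt f' g' := by
  obtain ⟨w, h⟩ := h
  have w' : f' ≫ g' = 0 := by
    rw [← cancel_epi a.hom, ← reassoc_of% hf, ← hg, reassoc_of% w, zero_comp, comp_zero]
  exact ⟨w', (ShortComplex.exact_iff_of_iso
    (ShortComplex.isoMk (S₁ := .mk f g w) (S₂ := .mk f' g' w') a b c hf.symm hg.symm)).1 h⟩

namespace RelCohomology

/-- The push-forward `G_* H` of a relative cohomology along an exact functor. -/
def pushforward (H : RelCohomology.{u₁, v₁} R W) {B : Type u₂} [Category.{v₂} B] [Abelian B]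
    [Linear R B] (G : H.A ⥤ B) (hG : IsExact G) : RelCohomology.{u₂, v₂} R W where
  A := B
  H i := H.H i ⋙ G
  δ i t := G.map (H.δ i t)
  δ_naturality i t t' f := by
    have h := congr(G.map $(H.δ_naturality i f))
    rw [G.map_comp, G.map_comp] at h
    exact h
  mono t := by
    have := H.mono t
    have := hG.1
    exact inferInstanceAs (Mono (G.map _))
  exact_XZ i t := (H.exact_XZ i t).map hG
  exact_YZ i t := (H.exact_YZ i t).map hG
  exact_XY i t := (H.exact_XY i t).map hG

/-- `H'` is the push-forward of `H` along `G`, up to an isomorphism compatible with the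
boundary maps. -/
def IsPushforward (H : RelCohomology.{u₁, v₁} R W) (H' : RelCohomology.{u₂, v₂} R W)
    (G : H.A ⥤ H'.A) : Prop :=
  ∃ e : ∀ i, H.H i ⋙ G ≅ H'.H i, ∀ (i : ℕ) (t : Triple W),
    G.map (H.δ i t) ≫ (e (i + 1)).hom.app (op t.XY) = (e i).hom.app (op t.YZ) ≫ H'.δ i t

/-- `H'` is a realisation of `H` along `G`: the functor `G` is faithful, exact and `R`-linear, and
`H'` is the push-forward of `H` along `G`. -/
structure IsRealisation (H : RelCohomology.{u₁, v₁} R W) (H' : RelCohomology.{u₂, v₂} R W)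
    (G : H.A ⥤ H'.A) : Prop where
  faithful : G.Faithful
  exact : IsExactLinear R G
  isPushforward : H.IsPushforward H' G

variable (R W) in
lemma isZero_proj_of_defect {D : FreeRel.{w} R W} (hD : exactnessDefect R W D) :
    IsZero ((SerreQuotient.proj (serreClosure (exactnessDefect.{w} R W))).obj D) :=
  SerreQuotient.le_Ker_proj (le_serreClosure _) _ hD

variable (R W) in
/-- The universal relative cohomology `U_∂`, with values in `𝒜_∂(C)`. -/
noncomputable def univ :
    RelCohomology.{max (w + 1) (r + 1) (v + 1) (u + 1),
      max (w + 1) (r + 1) (v + 1) (u + 1)} R W where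
  A := UnivRel.{w} R W
  H i := FreeRel.H R W i ⋙ SerreQuotient.proj _
  δ i t := (SerreQuotient.proj _).map (FreeRel.δ R i t)
  δ_naturality i t t' f := by
    have h := congr((SerreQuotient.proj (serreClosure (exactnessDefect.{w} R W))).map
      ((FreeAb.incl.{max w r v u} R (BoundaryCat W)).map $(BoundaryCat.naturality i f)))
    simp only [Functor.map_comp] at h
    exact h
  mono t := by
    have hG := SerreQuotient.proj_isExact (serreClosure (exactnessDefect.{w} R W))
    have := hG.1
    have := hG.2
    have := (SerreQuotient.proj
      (serreClosure (exactnessDefect.{w} R W))).additive_of_preserves_binary_products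
    exact Preadditive.mono_of_isZero_kernel _
      ((isZero_proj_of_defect R W (.mono t)).of_iso (PreservesKernel.iso
        (SerreQuotient.proj (serreClosure (exactnessDefect.{w} R W)))
        ((FreeRel.H R W 0).map t.toXY.op)).symm)
  exact_XZ i t := (exactAt_map_iff (SerreQuotient.proj_isExact _) _ _).2
    fun D hD => isZero_proj_of_defect R W (.exact_XZ i t hD)
  exact_YZ i t := (exactAt_map_iff (SerreQuotient.proj_isExact _) _ _).2
    fun D hD => isZero_proj_of_defect R W (.exact_YZ i t hD)
  exact_XY i t := (exactAt_map_iff (SerreQuotient.proj_isExact _) _ _).2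
    fun D hD => isZero_proj_of_defect R W (.exact_XY i t hD)

variable (H : RelCohomology.{u₁, v₁} R W)

/-- A relative cohomology gives a representation of the generators of `BoundaryCat W`. -/
def prefunctor : Vertex W ⥤q H.A where
  obj x := (H.H x.degree).obj (op x.pair)
  map a := match a with
    | .map f i => (H.H i).map f.op
    | .δ i t => H.δ i t

lemma lift_edgeMap {p q : Pairs W} (f : p ⟶ q) (i : ℕ) :
    (Paths.lift H.prefunctor).map (edgeMap f i) = (H.H i).map f.op :=
  Paths.lift_toPath _ _

lemma lift_edgeδ (i : ℕ) (t : Triple W) :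
    (Paths.lift H.prefunctor).map (edgeδ i t) = H.δ i t :=
  Paths.lift_toPath _ _

/-- A relative cohomology, as a functor on `BoundaryCat W`. -/
def toFunctor : BoundaryCat W ⥤ H.A :=
  CategoryTheory.Quotient.lift (Relation W) (Paths.lift H.prefunctor) (by
    intro _ _ _ _ h
    cases h with
    | id p i =>
      rw [lift_edgeMap, CategoryTheory.Functor.map_id]
      exact (H.H i).map_id _
    | comp f g i =>
      rw [Functor.map_comp, lift_edgeMap, lift_edgeMap, lift_edgeMap]
      exact (H.H i).map_comp g.op f.op
    | naturality i f =>
      rw [Functor.map_comp, Functor.map_comp, lift_edgeMap, lift_edgeMap, lift_edgeδ, lift_edgeδ]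
      exact H.δ_naturality i f)

lemma toFunctor_map_H (i : ℕ) {p q : (Pairs W)ᵒᵖ} (f : p ⟶ q) :
    H.toFunctor.map ((BoundaryCat.H W i).map f) = (H.H i).map f := H.lift_edgeMap f.unop i

lemma toFunctor_map_δ (i : ℕ) (t : Triple W) :
    H.toFunctor.map (BoundaryCat.δ i t) = H.δ i t := H.lift_edgeδ i t

theorem exists_classifying : ∃ F : UnivRel.{max u₁ v₁} R W ⥤ H.A,
    IsExactLinear R F ∧ (univ.{max u₁ v₁} R W).IsPushforward H F := by
  obtain ⟨F, h₁, h₂, h₃, ⟨e⟩⟩ := FreeAb.exists_lift.{max r v u} R H.toFunctor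
  have hF : IsExactLinear R F := ⟨⟨h₁, h₂⟩, h₃⟩
  have := F.additive_of_preserves_binary_products
  let ε (i : ℕ) (p : (Pairs W)ᵒᵖ) : F.obj ((FreeRel.H.{max u₁ v₁} R W i).obj p) ≅
      (H.H i).obj p := e.app ((BoundaryCat.H W i).obj p)
  have hε (i : ℕ) {p q : (Pairs W)ᵒᵖ} (f : p ⟶ q) :
      F.map ((FreeRel.H.{max u₁ v₁} R W i).map f) ≫ (ε i q).hom =
        (ε i p).hom ≫ (H.H i).map f := by
    rw [← toFunctor_map_H]
    exact e.hom.naturality ((BoundaryCat.H W i).map f)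
  have hδ (i : ℕ) (t : Triple W) :
      F.map (FreeRel.δ.{max u₁ v₁} R i t) ≫ (ε (i + 1) _).hom = (ε i _).hom ≫ H.δ i t := by
    rw [← toFunctor_map_δ]
    exact e.hom.naturality (BoundaryCat.δ i t)
  have inv {P Q P' Q' : H.A} {a : P ≅ P'} {b : Q ≅ Q'} {f : P ⟶ Q} {g : P' ⟶ Q'}
      (h : f ≫ b.hom = a.hom ≫ g) : g ≫ b.symm.hom = a.symm.hom ≫ f := by
    simp [← cancel_epi a.hom, ← reassoc_of% h]
  have hle : exactnessDefect.{max u₁ v₁} R W ≤ Ker F := by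
    intro D hD
    cases hD with
    | mono t =>
      have := H.mono t
      have : Mono (F.map ((FreeRel.H.{max u₁ v₁} R W 0).map t.toXY.op)) := by
        have h : Mono (F.map ((FreeRel.H.{max u₁ v₁} R W 0).map t.toXY.op) ≫ (ε 0 _).hom) := by
          rw [hε]
          infer_instance
        exact mono_of_mono _ (ε 0 _).hom
      exact (isZero_kernel_of_mono (F.map ((FreeRel.H.{max u₁ v₁} R W 0).map t.toXY.op))).of_iso
        (PreservesKernel.iso F _)
    | exact_XZ i t h =>
      exact (exactAt_map_iff hF.toIsExact _ _).1 ((H.exact_XZ i t).of_iso (ε i _).symm (ε i _).symm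
        (ε i _).symm (inv (hε i _)) (inv (hε i _))) D h
    | exact_YZ i t h =>
      exact (exactAt_map_iff hF.toIsExact _ _).1 ((H.exact_YZ i t).of_iso (ε i _).symm (ε i _).symm
        (ε (i + 1) _).symm (inv (hε i _)) (inv (hδ i t))) D h
    | exact_XY i t h =>
      exact (exactAt_map_iff hF.toIsExact _ _).1 ((H.exact_XY i t).of_iso (ε i _).symm
        (ε (i + 1) _).symm (ε (i + 1) _).symm (inv (hδ i t)) (inv (hε (i + 1) _))) D h
  have : (Ker F).IsSerreClass := Ker_isSerreClass hF.toIsExact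
  have hle' := serreClosure_le hle
  let φ := SerreQuotient.fac hF.toIsExact _ hle'
  refine ⟨SerreQuotient.lift hF.toIsExact _ hle', SerreQuotient.lift_isExactLinear hF _ hle',
    fun i => Functor.isoWhiskerLeft (FreeRel.H.{max u₁ v₁} R W i) φ ≪≫
      NatIso.ofComponents (ε i) (fun f => hε i f), fun i t => ?_⟩
  have h := φ.hom.naturality (FreeRel.δ.{max u₁ v₁} R i t)
  change _ ≫ φ.hom.app _ ≫ (ε (i + 1) _).hom = (φ.hom.app _ ≫ (ε i _).hom) ≫ _
  rw [Category.assoc, ← hδ i t]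
  refine (Category.assoc _ _ _).symm.trans (Eq.trans ?_ (Category.assoc _ _ _))
  exact congr($h ≫ (ε (i + 1) _).hom)

/-- The exact `R`-linear functor `F_H^∂ : 𝒜_∂(C) ⥤ A` through which `H` is the push-forward
of `U_∂`. -/
noncomputable def classifying : UnivRel.{max u₁ v₁} R W ⥤ H.A := H.exists_classifying.choose

lemma classifying_isExactLinear : IsExactLinear R H.classifying :=
  H.exists_classifying.choose_spec.1

lemma classifying_isPushforward : (univ.{max u₁ v₁} R W).IsPushforward H H.classifying :=
  H.exists_classifying.choose_spec.2

/-- `Ker F_H^∂`. -/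
abbrev kernel : ObjectProperty (UnivRel.{max u₁ v₁} R W) := Ker H.classifying

instance : H.kernel.IsSerreClass := Ker_isSerreClass H.classifying_isExactLinear.toIsExact

/-- `𝒜_∂(H) = 𝒜_∂(C) / Ker F_H^∂`. -/
abbrev Quot := SerreQuotient H.kernel

/-- Two relative cohomologies are `∂`-equivalent if there is an equivalence `𝒜_∂(H) ≌ 𝒜_∂(H')`
compatible with the projections from `𝒜_∂(C)`. -/
def IsEquivalent (H H' : RelCohomology.{u₁, v₁} R W) : Prop :=
  ∃ e : H.Quot ≌ H'.Quot,
    Nonempty (SerreQuotient.proj H.kernel ⋙ e.functor ≅ SerreQuotient.proj H'.kernel)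

variable (S : Set (RelCohomology.{u₁, v₁} R W))

/-- `ℐ_{∂,S}`, the intersection of the kernels `Ker F_H^∂` for `H ∈ S`. -/
def commonKernel : ObjectProperty (UnivRel.{max u₁ v₁} R W) := fun X => ∀ H : S, H.1.kernel X

instance : (commonKernel S).IsSerreClass := isSerreClass_forall fun H : S => H.1.kernel

lemma commonKernel_le {S : Set (RelCohomology.{u₁, v₁} R W)} {H : RelCohomology.{u₁, v₁} R W}
    (hH : H ∈ S) : commonKernel S ≤ H.kernel := fun _ hX => hX ⟨H, hH⟩

/-- `𝒜_{∂,S}(C) = 𝒜_∂(C) / ℐ_{∂,S}`. -/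
abbrev ClassQuot := SerreQuotient (commonKernel S)

/-- `U_{∂,S}`, the push-forward of `U_∂` along the projection to `𝒜_{∂,S}(C)`. -/
noncomputable abbrev classUniv :=
  (univ.{max u₁ v₁} R W).pushforward (SerreQuotient.proj (commonKernel S))
    (SerreQuotient.proj_isExact (commonKernel S))

variable {S} {H} (hH : H ∈ S)

/-- `r_{∂,H} : 𝒜_{∂,S}(C) ⥤ A`, the functor induced by `F_H^∂`. -/
noncomputable def realisation : ClassQuot S ⥤ H.A :=
  SerreQuotient.lift H.classifying_isExactLinear.toIsExact (commonKernel S) (commonKernel_le hH)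

/-- The further quotient `𝒜_{∂,S}(C) ⥤ 𝒜_∂(H)`. -/
noncomputable def toQuot : ClassQuot S ⥤ H.Quot := SerreQuotient.map (commonKernel_le hH)

end RelCohomology

end Relative

end UnivCoh

/-!
All four conditions say that the kernels `Ker F_H` agree. A Serre subcategory `P` is recovered from
its quotient, as the objects which the projection sends to zero (`SerreQuotient.Ker_proj`). Hence an
equivalence between two quotients that is compatible with the projections exists exactly when the
Serre subcategories coincide (`SerreQuotient.exists_equivalence_iff`), and the further quotient
`𝒰 / P ⥤ 𝒰 / Q` is an equivalence exactly when `P = Q` (`SerreQuotient.map_isEquivalence_iff`).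

An exact functor is faithful as soon as it sends no nonzero object to zero
(`IsExact.faithful_of_isZero`), so the functor induced on `𝒰 / P` by an exact functor `F` is faithful
exactly when `P = Ker F` (`SerreQuotient.lift_faithful_iff`). The functors `r_H` are always exact and
linear and carry `U_S` to `H`, so being a realisation along `r_H` amounts to faithfulness of `r_H`,
that is to `ℐ_S = Ker F_H`. Finally, the kernels agree with each other exactly when each of them is
equal to their intersection `ℐ_S`.
-/

namespace UnivCoh

lemma IsExact.faithful_of_isZero {𝒰 : Type u} [Category.{v} 𝒰] [Abelian 𝒰] {A : Type u₁}
    [Category.{v₁} A] [Abelian A] {F : 𝒰 ⥤ A} (hF : IsExact F)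
    (h : ∀ X, IsZero (F.obj X) → IsZero X) : F.Faithful where
  map_injective {X Y f g} hfg := by
    have := hF.1
    have := hF.2
    have := F.additive_of_preserves_binary_products
    have hz : IsZero (Abelian.image (f - g)) :=
      h _ ((isZero_map_image_iff hF _).2 (by rw [F.map_sub, hfg, sub_self]))
    rw [← sub_eq_zero, ← Abelian.image.fac (f - g), hz.eq_of_tgt (Abelian.factorThruImage _) 0,
      zero_comp]

/-- All members of a family of properties coincide exactly when each is the intersection of all of
them. -/
lemma forall_eq_iff_forall_inf_eq {ι : Sort*} {T : Type*} (P : ι → T → Prop) :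
    (∀ i j, P i = P j) ↔ ∀ i, (fun X => ∀ j, P j X) = P i :=
  ⟨fun h i => funext fun _ => propext ⟨fun hX => hX i, fun hX j => h i j ▸ hX⟩,
    fun h i j => (h i).symm.trans (h j)⟩

namespace SerreQuotient

variable {𝒰 : Type u} [Category.{v} 𝒰] [Abelian 𝒰] {A : Type u₁} [Category.{v₁} A]
  {P Q : ObjectProperty 𝒰} [P.IsSerreClass] [Q.IsSerreClass]

variable (P) in
lemma Ker_proj : Ker (proj P) = P :=
  funext fun X => propext (ObjectProperty.SerreClassLocalization.isZero_obj_iff (proj P) P X)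

/-- If a functor factors through the quotient by `P` and the second factor preserves and detects zero
objects, then its kernel is that of the projection, namely `P`. -/
lemma eq_Ker_of_iso {F : 𝒰 ⥤ A} {G : SerreQuotient P ⥤ A} (e : proj P ⋙ G ≅ F)
    (hG : ∀ X, IsZero (G.obj X) ↔ IsZero X) : P = Ker F := by
  rw [← Ker_proj P]
  exact funext fun X => propext ((hG _).symm.trans (e.app X).isZero_iff)

lemma lift_faithful_iff [Abelian A] {F : 𝒰 ⥤ A} (hF : IsExact F) (h : P ≤ Ker F) :
    (lift hF P h).Faithful ↔ P = Ker F := by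
  have h' := hF.of_iso (fac hF P h).symm
  have hG : IsExact (lift hF P h) := by
    have : Localization.Lifting (proj P) P.isoModSerre F (lift hF P h) := ⟨fac hF P h⟩
    exact ⟨(ObjectProperty.SerreClassLocalization.preservesFiniteLimits_comp_iff _ P _).1 h'.1,
      (ObjectProperty.SerreClassLocalization.preservesFiniteColimits_comp_iff _ P _).1 h'.2⟩
  have := hG.1
  have := hG.2
  have := (lift hF P h).additive_of_preserves_binary_products
  constructor
  · intro _
    refine eq_Ker_of_iso (fac hF P h) fun X => ⟨fun hX => ?_, (lift hF P h).map_isZero⟩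
    rw [IsZero.iff_id_eq_zero] at hX ⊢
    exact (lift hF P h).map_injective (by simpa using hX)
  · intro hP
    refine hG.faithful_of_isZero fun X hX => ?_
    -- every object of the quotient is, up to isomorphism, the projection of an object of `𝒰`
    have := Localization.essSurj (proj P) P.isoModSerre
    have e := (proj P).objObjPreimageIso X
    have hz : Ker F ((proj P).objPreimage X) :=
      hX.of_iso ((fac hF P h).symm.app _ ≪≫ (lift hF P h).mapIso e)
    exact (le_Ker_proj le_rfl _ (hP ▸ hz)).of_iso e.symm

lemma map_isEquivalence_iff (h : P ≤ Q) : (map h).IsEquivalence ↔ P = Q := by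
  constructor
  · intro _
    exact ((lift_faithful_iff (proj_isExact Q) (le_Ker_proj h)).1
      (inferInstanceAs (map h).Faithful)).trans (Ker_proj Q)
  · rintro rfl
    exact Functor.isEquivalence_of_iso
      (Localization.isoUniqFunctor (proj P) (proj P) P.isoModSerre (map h)
        (fac (proj_isExact P) P (le_Ker_proj h))).symm

lemma exists_equivalence_iff :
    (∃ e : SerreQuotient P ≌ SerreQuotient Q, Nonempty (proj P ⋙ e.functor ≅ proj Q)) ↔ P = Q := by
  constructor
  · rintro ⟨e, ⟨i⟩⟩
    refine (eq_Ker_of_iso i fun X => ⟨fun hX => ?_, e.functor.map_isZero⟩).trans (Ker_proj Q)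
    exact (e.inverse.map_isZero hX).of_iso (e.unitIso.app X)
  · rintro rfl
    exact ⟨.refl, ⟨Functor.rightUnitor _⟩⟩

end SerreQuotient

section

variable {R : Type r} [CommRing R] {C : Type u} [Category.{v} C]

namespace Cohomology

variable {S : Set (Cohomology.{u₁, v₁} R C)} {H : Cohomology.{u₁, v₁} R C}

lemma classUniv_isRealisation_iff (hH : H ∈ S) :
    (classUniv S).IsRealisation H (realisation hH) ↔ commonKernel S = H.kernel := by
  have hF := H.classifying_isExactLinear
  rw [← SerreQuotient.lift_faithful_iff hF.toIsExact (commonKernel_le hH)]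
  refine ⟨fun h => h.faithful, fun h => ⟨h, SerreQuotient.lift_isExactLinear hF _ _, fun i => ?_⟩⟩
  obtain ⟨e⟩ := H.classifying_isPushforward i
  exact ⟨Functor.isoWhiskerLeft ((univ.{max u₁ v₁} R C).H i)
    (SerreQuotient.fac hF.toIsExact _ (commonKernel_le hH)) ≪≫ e⟩

lemma kernel_eq_iff_commonKernel_eq :
    (∀ H ∈ S, ∀ H' ∈ S, H.kernel = H'.kernel) ↔ ∀ H ∈ S, commonKernel S = H.kernel := by
  have h := forall_eq_iff_forall_inf_eq fun H : S => H.1.kernel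
  exact ⟨fun hS H hH => h.1 (fun i j => hS _ i.2 _ j.2) ⟨H, hH⟩,
    fun hS H hH H' hH' => h.2 (fun i => hS _ i.2) ⟨H, hH⟩ ⟨H', hH'⟩⟩

end Cohomology

namespace RelCohomology

variable {W : MorphismProperty C} [W.IsStableUnderComposition]
  {S : Set (RelCohomology.{u₁, v₁} R W)} {H : RelCohomology.{u₁, v₁} R W}

lemma classUniv_isRealisation_iff (hH : H ∈ S) :
    (classUniv S).IsRealisation H (realisation hH) ↔ commonKernel S = H.kernel := by
  have hF := H.classifying_isExactLinear
  rw [← SerreQuotient.lift_faithful_iff hF.toIsExact (commonKernel_le hH)]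
  refine ⟨fun h => h.faithful, fun h => ⟨h, SerreQuotient.lift_isExactLinear hF _ _, ?_⟩⟩
  obtain ⟨e, he⟩ := H.classifying_isPushforward
  let φ := SerreQuotient.fac hF.toIsExact _ (commonKernel_le hH)
  refine ⟨fun i => Functor.isoWhiskerLeft ((univ.{max u₁ v₁} R W).H i) φ ≪≫ e i, fun i t => ?_⟩
  have h₁ := φ.hom.naturality ((univ.{max u₁ v₁} R W).δ i t)
  change _ ≫ φ.hom.app _ ≫ (e (i + 1)).hom.app _ = (φ.hom.app _ ≫ (e i).hom.app _) ≫ _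
  rw [Category.assoc, ← he i t]
  refine (Category.assoc _ _ _).symm.trans (Eq.trans ?_ (Category.assoc _ _ _))
  exact congr($h₁ ≫ (e (i + 1)).hom.app (op t.XY))

lemma kernel_eq_iff_commonKernel_eq :
    (∀ H ∈ S, ∀ H' ∈ S, H.kernel = H'.kernel) ↔ ∀ H ∈ S, commonKernel S = H.kernel := by
  have h := forall_eq_iff_forall_inf_eq fun H : S => H.1.kernel
  exact ⟨fun hS H hH => h.1 (fun i j => hS _ i.2 _ j.2) ⟨H, hH⟩,
    fun hS H hH H' hH' => h.2 (fun i => hS _ i.2) ⟨H, hH⟩ ⟨H', hH'⟩⟩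

end RelCohomology

end

end UnivCoh

theorem proposition1p2 {R : Type r} [CommRing R] {C : Type u} [Category.{v} C] :
    (∀ S : Set (UnivCoh.Cohomology.{u₁, v₁} R C), List.TFAE [
      ∀ H ∈ S, ∀ H' ∈ S, H.IsEquivalent H',
      ∀ H ∈ S, ∀ H' ∈ S, H.kernel = H'.kernel,
      ∀ H (hH : H ∈ S), (UnivCoh.Cohomology.classUniv S).IsRealisation H
        (UnivCoh.Cohomology.realisation hH),
      ∀ H (hH : H ∈ S), (UnivCoh.Cohomology.toQuot hH).IsEquivalence]) ∧
    (∀ (W : MorphismProperty C) [W.IsStableUnderComposition]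
      (S : Set (UnivCoh.RelCohomology.{u₁, v₁} R W)), List.TFAE [
      ∀ H ∈ S, ∀ H' ∈ S, H.IsEquivalent H',
      ∀ H ∈ S, ∀ H' ∈ S, H.kernel = H'.kernel,
      ∀ H (hH : H ∈ S), (UnivCoh.RelCohomology.classUniv S).IsRealisation H
        (UnivCoh.RelCohomology.realisation hH),
      ∀ H (hH : H ∈ S), (UnivCoh.RelCohomology.toQuot hH).IsEquivalence]) := by
  refine ⟨fun S => ?_, fun W _ S => ?_⟩
  · tfae_have 1 ↔ 2 := forall₄_congr fun H _ H' _ => UnivCoh.SerreQuotient.exists_equivalence_iff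
    tfae_have 2 ↔ 3 := UnivCoh.Cohomology.kernel_eq_iff_commonKernel_eq.trans
      (forall₂_congr fun H hH => (UnivCoh.Cohomology.classUniv_isRealisation_iff hH).symm)
    tfae_have 2 ↔ 4 := UnivCoh.Cohomology.kernel_eq_iff_commonKernel_eq.trans
      (forall₂_congr fun H hH => (UnivCoh.SerreQuotient.map_isEquivalence_iff _).symm)
    tfae_finish
  · tfae_have 1 ↔ 2 := forall₄_congr fun H _ H' _ => UnivCoh.SerreQuotient.exists_equivalence_iff
    tfae_have 2 ↔ 3 := UnivCoh.RelCohomology.kernel_eq_iff_commonKernel_eq.trans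
      (forall₂_congr fun H hH => (UnivCoh.RelCohomology.classUniv_isRealisation_iff hH).symm)
    tfae_have 2 ↔ 4 := UnivCoh.RelCohomology.kernel_eq_iff_commonKernel_eq.trans
      (forall₂_congr fun H hH => (UnivCoh.SerreQuotient.map_isEquivalence_iff _).symm)
    tfae_finish
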